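/- Let $d\ge 1$, let $\Omega\subset\mathbb R^d$ be a bounded domain, $0<\alpha<1$, and let $(\varphi_k)$ be an orthonormal basis of $L^2(\Omega)$ consisting of eigenfunctions of the Dirichlet Laplacian, $\varphi_k\in H_0^1(\Omega)$, $-\Delta\varphi_k=\theta_k\varphi_k$ (in the weak sense), with eigenvalues $\theta_k$ listed in increasing order. Let $D^1(\Omega)$ be the space of all $w\in L^2(\Omega)$ with $$\|w\|_{D^1}^2=\sum_k\theta_k\langle w,\varphi_k\rangle^2<\infty .$$ Write $E_{\alpha,\zeta}(z)=\sum_{k\ge0} z^k/\Gamma(\alpha k+\zeta)$, $E_\alpha=E_{\alpha,1}$, and $$S(t)w=\sum_k E_\alpha\Big(\tfrac{-\theta_kt^\alpha}{1+\theta_k}\Big)\langle w,\varphi_k\rangle\varphi_k,\qquad R(t)w=\sum_k \frac{t^{\alpha-1}}{1+\theta_k}E_{\alpha,\alpha}\Big(\tfrac{-\theta_kt^\alpha}{1+\theta_k}\Big)\langle w,\varphi_k\rangle\varphi_k .$$ For $\eta\in\mathbb R^d$ let $H(u)=(\eta\cdot\nabla)u$ with the weak gradient. For an interval $I\subseteq[0,\infty)$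 containing $0$ and $u_0\in D^1(\Omega)$, a mild solution on $I$ of $$\partial_t^\alpha u-\partial_t^\alpha\Delta u-\Delta u=H(u)\ \text{ in }\Omega,\qquad u=0\ \text{ on }\partial\Omega,\qquad u(0)=u_0,$$ is a function $u\in C(I\to D^1(\Omega))$ with $$u(t)=S(t)u_0+\int_0^tR(t-\tau)H(u(\tau))\,d\tau\quad\text{for all }t\in I$$ (a Bochner integral in $L^2(\Omega)$). **Theorem (uniqueness and stability).** 1. For all $\eta$, $I$ and $u_0\in D^1(\Omega)$, any two mild solutions on $I$ with initial value $u_0$ coincide on all of $I$. 2. Mild solutions depend continuously on the initial data: if $u$ is the mild solution on $I$ with initial value $u_0\in D^1(\Omega)$, then for all $T>0$ and $\varepsilon>0$ there is $\delta>0$ such that $\|u(t)-w(t)\|_{D^1}<\varepsilon$ for all $t\in I\cap[0,T]$ whenever $w$ is a mild solution on $I$ with initial value $w_0\in D^1(\Omega)$ and $\|u_0-w_0\|_{D^1}<\delta$. 3. There is a constant $C>0$, independent of $\eta$, and for every $\eta$ there is $\sigma>0$ such that, for every $I$ and all mild solutions $u,w$ on $I$ with initial values $u_0,w_0\in D^1(\Omega)$,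 $$t^\alpha e^{-\sigma t}\|u(t)-w(t)\|_{D^1}\le C\,\|u_0-w_0\|_{D^1}\,E_\alpha\Big(\tfrac34\Gamma(\alpha)t^\alpha\Big)\qquad\text{for all }t\in I .$$ -/

import Mathlib

open MeasureTheory Filter Topology
open scoped ContDiff ENNReal

noncomputable section

namespace FracSobolevGalpern

/-- The Euclidean space `ℝ^d`. -/
abbrev E (d : ℕ) : Type := EuclideanSpace ℝ (Fin d)

/-- The real Hilbert space `L²(Ω)` (Lebesgue measure on `Ω`). -/
abbrev L2 {d : ℕ} (Ω : Set (E d)) : Type := Lp ℝ 2 (volume.restrict Ω)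

/-- `ψ ∈ C_c^∞(Ω)`. -/
def IsTestFunction {d : ℕ} (Ω : Set (E d)) (ψ : E d → ℝ) : Prop :=
  ContDiff ℝ ∞ ψ ∧ HasCompactSupport ψ ∧ tsupport ψ ⊆ Ω

/-- The classical partial derivative `∂ψ/∂x_j`. -/
def partialDeriv {d : ℕ} (j : Fin d) (ψ : E d → ℝ) (x : E d) : ℝ :=
  fderiv ℝ ψ x (EuclideanSpace.single j 1)

/-- `g ∈ L²(Ω)` is the weak partial derivative `∂u/∂x_j` of `u ∈ L²(Ω)` in `Ω`. -/
def IsWeakPartialDeriv {d : ℕ} (Ω : Set (E d)) (j : Fin d) (u g : L2 Ω) : Prop :=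
  ∀ ψ : E d → ℝ, IsTestFunction Ω ψ →
    ∫ x in Ω, u x * partialDeriv j ψ x = - ∫ x in Ω, g x * ψ x

/-- Weak partial derivatives in an open set are unique. -/
theorem IsWeakPartialDeriv.unique {d : ℕ} {Ω : Set (E d)} (hΩ : IsOpen Ω) {j : Fin d}
    {u g h : L2 Ω} (hg : IsWeakPartialDeriv Ω j u g) (hh : IsWeakPartialDeriv Ω j u h) :
    g = h := by
  have hint : ∀ (f : L2 Ω) (ψ : E d → ℝ), IsTestFunction Ω ψ →
      Integrable (fun x => f x * ψ x) (volume.restrict Ω) := fun f ψ hψ =>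
    MemLp.integrable_mul (p := 2) (q := 2) (Lp.memLp f)
      ((hψ.1.continuous.memLp_of_hasCompactSupport hψ.2.1).restrict Ω)
  have hloc : LocallyIntegrableOn (fun x => g x - h x) Ω volume := by
    have h1 : LocallyIntegrable (fun x => g x - h x) (volume.restrict Ω) :=
      ((Lp.memLp g).sub (Lp.memLp h)).locallyIntegrable (by norm_num)
    exact locallyIntegrableOn_of_locallyIntegrable_restrict h1
  have key := hΩ.ae_eq_zero_of_integral_contDiff_smul_eq_zero hloc (fun ψ h1 h2 h3 => by
    have hψ : IsTestFunction Ω ψ := ⟨h1, h2, h3⟩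
    have e : ∫ x in Ω, ψ x • (g x - h x) = 0 := by
      have e1 : (fun x => ψ x • (g x - h x)) = fun x => g x * ψ x - h x * ψ x := by
        funext x; simp only [smul_eq_mul]; ring
      rw [e1, integral_sub (hint g ψ hψ) (hint h ψ hψ)]
      linarith [hg ψ hψ, hh ψ hψ]
    rw [← e, setIntegral_eq_integral_of_forall_compl_eq_zero]
    intro x hx
    rw [image_eq_zero_of_notMem_tsupport (fun hx' => hx (h3 hx')), zero_smul])
  refine Lp.ext ?_
  rw [Filter.EventuallyEq, ae_restrict_iff' hΩ.measurableSet]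
  filter_upwards [key] with x hx hxΩ
  exact sub_eq_zero.1 (hx hxΩ)

open Classical in
/-- The weak partial derivative `∂u/∂x_j ∈ L²(Ω)` (and `0` if there is none in `L²(Ω)`). -/
def weakPartialDeriv {d : ℕ} (Ω : Set (E d)) (j : Fin d) (u : L2 Ω) : L2 Ω :=
  if h : ∃ g, IsWeakPartialDeriv Ω j u g then h.choose else 0

/-- `u ∈ H_0^1(Ω)`: `u` has weak first derivatives in `L²(Ω)`, and `u` is a limit of functions of
`C_c^∞(Ω)` in the norm of `H^1(Ω)`. -/
def MemH10 {d : ℕ} (Ω : Set (E d)) (u : L2 Ω) : Prop :=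
  (∀ j, ∃ g, IsWeakPartialDeriv Ω j u g) ∧
  ∃ ψ : ℕ → E d → ℝ, (∀ n, IsTestFunction Ω (ψ n)) ∧
    Tendsto (fun n => eLpNorm (fun x => ψ n x - u x) 2 (volume.restrict Ω)) atTop (𝓝 0) ∧
    ∀ j, Tendsto (fun n => eLpNorm (fun x => partialDeriv j (ψ n) x - weakPartialDeriv Ω j u x) 2
      (volume.restrict Ω)) atTop (𝓝 0)

/-- `φ ∈ H_0^1(Ω)` solves `-Δφ = θφ` in `Ω`, `φ = 0` on `∂Ω`, in the weak (variational) sense. -/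
def IsDirichletEigenpair {d : ℕ} (Ω : Set (E d)) (θ : ℝ) (φ : L2 Ω) : Prop :=
  MemH10 Ω φ ∧ ∀ v : L2 Ω, MemH10 Ω v →
    ∑ j, inner ℝ (weakPartialDeriv Ω j φ) (weakPartialDeriv Ω j v) = θ * inner ℝ φ v

/-- The orthonormal basis `φ_0, φ_1, …` of `L²(Ω)` consists of eigenfunctions of the Dirichlet
Laplacian of `Ω`; the corresponding eigenvalues `θ_0 ≤ θ_1 ≤ …` are listed in increasing order. -/
def IsDirichletEigenbasis {d : ℕ} (Ω : Set (E d)) (θ : ℕ → ℝ)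
    (φ : HilbertBasis ℕ ℝ (L2 Ω)) : Prop :=
  Monotone θ ∧ ∀ k, IsDirichletEigenpair Ω (θ k) (φ k)

section Spectral

variable {d : ℕ} {Ω : Set (E d)} (θ : ℕ → ℝ) (φ : HilbertBasis ℕ ℝ (L2 Ω))

/-- Membership in the Hilbert scale space `D^ν(Ω)`. -/
def MemD (ν : ℝ) (w : L2 Ω) : Prop :=
  Summable fun k => θ k ^ ν * (inner ℝ w (φ k)) ^ 2

/-- The norm of `D^ν(Ω)`. -/
def normD (ν : ℝ) (w : L2 Ω) : ℝ :=
  √(∑' k, θ k ^ ν * (inner ℝ w (φ k)) ^ 2)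

/-- `u ∈ C(I → D^ν(Ω))`. -/
def ContinuousOnD (ν : ℝ) (I : Set ℝ) (u : ℝ → L2 Ω) : Prop :=
  (∀ t ∈ I, MemD θ φ ν (u t)) ∧
  ∀ t ∈ I, Tendsto (fun s => normD θ φ ν (u s - u t)) (𝓝[I] t) (𝓝 0)

/-- The Mittag-Leffler function `E_{α,ζ}(z) = ∑ z^k / Γ(αk + ζ)`. -/
def mittagLeffler (α ζ z : ℝ) : ℝ :=
  ∑' k : ℕ, z ^ k / Real.Gamma (α * k + ζ)

/-- `S(t)w = ∑ₖ E_α(-θₖ t^α / (1 + θₖ)) ⟨w, φₖ⟩ φₖ`. -/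
def opS (α t : ℝ) (w : L2 Ω) : L2 Ω :=
  ∑' k, (mittagLeffler α 1 (-θ k * t ^ α / (1 + θ k)) * inner ℝ w (φ k)) • φ k

/-- `R(t)w = ∑ₖ t^(α-1) / (1 + θₖ) E_{α,α}(-θₖ t^α / (1 + θₖ)) ⟨w, φₖ⟩ φₖ`. -/
def opR (α t : ℝ) (w : L2 Ω) : L2 Ω :=
  ∑' k, (t ^ (α - 1) / (1 + θ k) * mittagLeffler α α (-θ k * t ^ α / (1 + θ k)) *
    inner ℝ w (φ k)) • φ k

/-- The advection source `H(u) = (η · ∇)u`. -/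
def advection (η : E d) (u : L2 Ω) : L2 Ω :=
  ∑ j, η j • weakPartialDeriv Ω j u

/-- `u ∈ C(I → D^1(Ω))` is a mild solution on `I` of
`∂_t^α u - ∂_t^α Δu - Δu = (η · ∇)u`, `u = 0` on `∂Ω`, `u(0) = u₀`, that is,
`u(t) = S(t)u₀ + ∫_0^t R(t-τ) H(u(τ)) dτ` for `t ∈ I`. -/
def IsMildSolution (α : ℝ) (η : E d) (I : Set ℝ) (u₀ : L2 Ω) (u : ℝ → L2 Ω) : Prop :=
  ContinuousOnD θ φ 1 I u ∧
  ∀ t ∈ I,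
    IntervalIntegrable (fun τ => opR θ φ α (t - τ) (advection η (u τ))) volume 0 t ∧
    u t = opS θ φ α t u₀ + ∫ τ in (0 : ℝ)..t, opR θ φ α (t - τ) (advection η (u τ))

end Spectral

/-- `I ⊆ [0, ∞)` is an interval of time that starts at `0`:
`[0, T]`, `[0, T)` or `[0, ∞)`. -/
def IsTimeInterval (I : Set ℝ) : Prop :=
  (0 : ℝ) ∈ I ∧ I ⊆ Set.Ici 0 ∧ I.OrdConnected

end FracSobolevGalpern

end

open FracSobolevGalpern

/-! All three parts follow from one Gronwall-type bound, `exists_normD_sub_le`: the difference of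
two mild solutions grows at most like `M * exp (σ * t)` times the difference of the data in `D^1`,
with `M` independent of `η`.

By linearity the difference `v` satisfies the mild equation with data `u₀ - w₀`. For `w` in `D^1`
the norm is exactly that of the weak gradient (`memH1_and_norm_weakGrad`), so `‖H(v)‖ ≤ ‖η‖
‖v‖_{D^1}`. The factor `1 / (1 + θ k)` makes `R(s)` map `L²` into `D^1` with norm at most a constant
times `s ^ (α - 1) * exp (2 * s)`. In the weighted norm `sup exp (-(r + 2) * τ) ‖v(τ)‖` the integral
term then carries a factor `O(r ^ (-α))`; a large `r`, depending on `η`, makes it at most `1/2`, and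
the term is absorbed. A crude exponential bound on the Mittag-Leffler functions suffices. -/

namespace FracSobolevGalpern

/-! ### The Mittag-Leffler function -/

/-- Restrict the Gamma integral to `x > t`, where `x ^ s ≥ t ^ s`. -/
theorem rpow_le_exp_mul_Gamma {s t : ℝ} (hs : 0 ≤ s) (ht : 0 ≤ t) :
    t ^ s ≤ Real.exp t * Real.Gamma (s + 1) := by
  have h1 : t ^ s * Real.exp (-t) ≤ Real.Gamma (s + 1) := by
    rw [Real.Gamma_eq_integral (by linarith), ← integral_exp_neg_Ioi t, ← integral_const_mul]
    have hint := Real.GammaIntegral_convergent (s := s + 1) (by linarith)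
    calc ∫ x in Set.Ioi t, t ^ s * Real.exp (-x)
        ≤ ∫ x in Set.Ioi t, Real.exp (-x) * x ^ (s + 1 - 1) := by
          refine setIntegral_mono_on ((integrableOn_exp_neg_Ioi t).const_mul _)
            (hint.mono_set (Set.Ioi_subset_Ioi ht)) measurableSet_Ioi fun x hx => ?_
          rw [add_sub_cancel_right, mul_comm]
          exact mul_le_mul_of_nonneg_left (Real.rpow_le_rpow ht (le_of_lt hx) hs) (Real.exp_pos _).le
      _ ≤ _ := by
          refine setIntegral_mono_set hint ?_ (Set.Ioi_subset_Ioi ht).eventuallyLE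
          filter_upwards [ae_restrict_mem measurableSet_Ioi] with x hx
          have : (0 : ℝ) < x := hx
          simp only [Pi.zero_apply]; positivity
  calc t ^ s = Real.exp t * (t ^ s * Real.exp (-t)) := by
        rw [mul_left_comm, ← Real.exp_add, add_neg_cancel, Real.exp_zero, mul_one]
    _ ≤ _ := mul_le_mul_of_nonneg_left h1 (Real.exp_pos _).le

theorem rpow_pow_div_Gamma_le {α ζ t : ℝ} (hα : 0 < α) (hζ : 0 < ζ) (ht : 0 ≤ t) (k : ℕ) :
    (t ^ α) ^ k / Real.Gamma (α * k + ζ) ≤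
      Real.exp (2 * t + 1) * ((α * k + ζ) * ((2 : ℝ) ^ (-α)) ^ k) := by
  have hk : 0 ≤ α * k := by positivity
  have hs : 0 < α * k + ζ := by linarith
  have h2 : (2 * t) ^ (α * k) ≤ Real.exp (2 * t + 1) * ((α * k + ζ) * Real.Gamma (α * k + ζ)) := by
    calc (2 * t) ^ (α * k) ≤ (2 * t + 1) ^ (α * k) :=
          Real.rpow_le_rpow (by linarith) (by linarith) hk
      _ ≤ (2 * t + 1) ^ (α * k + ζ) := Real.rpow_le_rpow_of_exponent_le (by linarith) (by linarith)
      _ ≤ _ := rpow_le_exp_mul_Gamma hs.le (by linarith)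
      _ = _ := by rw [Real.Gamma_add_one hs.ne']
  -- Doubling `t` leaves the geometric factor `2 ^ (-α * k)`, which makes the series over `k`
  -- converge.
  have h3 : (t ^ α) ^ k = (2 * t) ^ (α * k) * ((2 : ℝ) ^ (-α)) ^ k := by
    rw [Real.mul_rpow zero_le_two ht, ← Real.rpow_mul_natCast ht, ← Real.rpow_mul_natCast zero_le_two,
      mul_right_comm, ← Real.rpow_add zero_lt_two, neg_mul, add_neg_cancel, Real.rpow_zero, one_mul]
  rw [div_le_iff₀ (Real.Gamma_pos_of_pos hs), h3]
  calc _ ≤ Real.exp (2 * t + 1) * ((α * k + ζ) * Real.Gamma (α * k + ζ)) * ((2 : ℝ) ^ (-α)) ^ k :=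
        mul_le_mul_of_nonneg_right h2 (by positivity)
    _ = _ := by ring

theorem summable_linear_mul_two_rpow_neg_pow {α : ℝ} (hα : 0 < α) (ζ : ℝ) :
    Summable fun k : ℕ => (α * k + ζ) * ((2 : ℝ) ^ (-α)) ^ k := by
  have hr : ‖(2 : ℝ) ^ (-α)‖ < 1 := by
    rw [Real.norm_of_nonneg (by positivity)]
    exact Real.rpow_lt_one_of_one_lt_of_neg one_lt_two (by linarith)
  have h0 := (summable_pow_mul_geometric_of_norm_lt_one 1 hr).mul_left α
  have h1 := (summable_geometric_of_norm_lt_one hr).mul_left ζ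
  refine (h0.add h1).congr fun k => ?_
  ring

theorem summable_mittagLeffler_and_abs_le {α ζ t z : ℝ} (hα : 0 < α) (hζ : 0 < ζ) (ht : 0 ≤ t)
    (hz : |z| ≤ t ^ α) :
    (Summable fun k : ℕ => z ^ k / Real.Gamma (α * k + ζ)) ∧
      |mittagLeffler α ζ z| ≤
        Real.exp (2 * t + 1) * ∑' k : ℕ, (α * k + ζ) * ((2 : ℝ) ^ (-α)) ^ k := by
  have hb : ∀ k : ℕ, ‖z ^ k / Real.Gamma (α * k + ζ)‖ ≤
      Real.exp (2 * t + 1) * ((α * k + ζ) * ((2 : ℝ) ^ (-α)) ^ k) := fun k => by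
    have hG : 0 < Real.Gamma (α * k + ζ) := Real.Gamma_pos_of_pos (by positivity)
    rw [norm_div, norm_pow, Real.norm_eq_abs, Real.norm_of_nonneg hG.le]
    refine le_trans ?_ (rpow_pow_div_Gamma_le hα hζ ht k)
    gcongr
  have hs := (summable_linear_mul_two_rpow_neg_pow hα ζ).mul_left (Real.exp (2 * t + 1))
  refine ⟨.of_norm_bounded hs hb, ?_⟩
  rw [← tsum_mul_left, ← Real.norm_eq_abs]
  exact tsum_of_norm_bounded hs.hasSum hb

/-- The arguments of the Mittag-Leffler functions in `opS` and `opR` satisfy `|z| ≤ t ^ α`, because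
`θ k / (1 + θ k) ≤ 1`; the bound is therefore uniform in `k`. -/
theorem exists_abs_mittagLeffler_le {α ζ : ℝ} (hα : 0 < α) (hζ : 0 < ζ) :
    ∃ M > 0, ∀ t z : ℝ, 0 ≤ t → |z| ≤ t ^ α → |mittagLeffler α ζ z| ≤ M * Real.exp (2 * t) := by
  refine ⟨Real.exp 1 * ∑' k : ℕ, (α * k + ζ) * ((2 : ℝ) ^ (-α)) ^ k, ?_, fun t z ht hz => ?_⟩
  · refine mul_pos (Real.exp_pos 1) ?_
    exact (summable_linear_mul_two_rpow_neg_pow hα ζ).tsum_pos (fun k => by positivity) 0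
      (by simpa using hζ)
  · refine (summable_mittagLeffler_and_abs_le hα hζ ht hz).2.trans (le_of_eq ?_)
    rw [Real.exp_add]; ring

theorem one_le_mittagLeffler {α x : ℝ} (hα : 0 < α) (hx : 0 ≤ x) : 1 ≤ mittagLeffler α 1 x := by
  -- Summability is needed to bound the sum below by its term `k = 0`, which is `1 / Γ(1) = 1`.
  have hs := (summable_mittagLeffler_and_abs_le (z := x) (t := x ^ α⁻¹) hα one_pos (by positivity)
    (by rw [Real.rpow_inv_rpow hx hα.ne', abs_of_nonneg hx])).1
  refine le_trans (by simp) (hs.le_tsum 0 fun k _ => ?_)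
  have : 0 < Real.Gamma (α * k + 1) := Real.Gamma_pos_of_pos (by positivity)
  positivity

/-! ### Weakly singular integrals -/

/-- After the substitution `s = t - τ`, enlarging the domain to `(0, ∞)` gives a Gamma integral; the
bound is uniform in `t` and decays as `r` grows. -/
theorem integral_rpow_mul_exp_neg_le {α r t : ℝ} (hα : 0 < α) (hr : 0 < r) (ht : 0 ≤ t) :
    IntervalIntegrable (fun τ => (t - τ) ^ (α - 1) * Real.exp (-(r * (t - τ)))) volume 0 t ∧
      ∫ τ in (0 : ℝ)..t, (t - τ) ^ (α - 1) * Real.exp (-(r * (t - τ))) ≤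
        (1 / r) ^ α * Real.Gamma α := by
  have hI : IntegrableOn (fun s : ℝ => s ^ (α - 1) * Real.exp (-(r * s))) (Set.Ioi 0) := by
    have := integrableOn_rpow_mul_exp_neg_mul_rpow (p := 1) (s := α - 1) (b := r) (by linarith)
      one_pos hr
    simpa [Real.rpow_one] using this
  have hi : IntervalIntegrable (fun s : ℝ => s ^ (α - 1) * Real.exp (-(r * s))) volume 0 t :=
    (intervalIntegrable_iff_integrableOn_Ioc_of_le ht).2 (hI.mono_set Set.Ioc_subset_Ioi_self)
  constructor
  · simpa using (hi.comp_sub_left t).symm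
  · rw [intervalIntegral.integral_comp_sub_left
      (fun s : ℝ => s ^ (α - 1) * Real.exp (-(r * s))) t, sub_self, sub_zero,
      intervalIntegral.integral_of_le ht, ← Real.integral_rpow_mul_exp_neg_mul_Ioi hα hr]
    refine setIntegral_mono_set hI ?_ Set.Ioc_subset_Ioi_self.eventuallyLE
    filter_upwards [ae_restrict_mem measurableSet_Ioi] with x hx
    have : (0 : ℝ) < x := hx
    simp only [Pi.zero_apply]; positivity

theorem exists_const_mul_rpow_inv_le_half {α : ℝ} (hα : 0 < α) (A : ℝ) :
    ∃ r : ℝ, 0 < r ∧ A * (1 / r) ^ α ≤ 1 / 2 := by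
  have h : Tendsto (fun r : ℝ => A * (1 / r) ^ α) atTop (𝓝 (A * 0)) := by
    refine (tendsto_rpow_neg_atTop hα).const_mul A |>.congr' ?_
    filter_upwards [eventually_gt_atTop 0] with r hr
    rw [Real.rpow_neg hr.le, one_div, Real.inv_rpow hr.le]
  rw [mul_zero] at h
  obtain ⟨r, hr, hr0⟩ := ((h.eventually (ge_mem_nhds (by norm_num : (0 : ℝ) < 1 / 2))).and
    (eventually_gt_atTop 0)).exists
  exact ⟨r, hr0, hr⟩

/-! ### Orthogonal series -/

/-- Pythagoras, applied to the lines spanned by the `g i`; no normalization is needed, so some `g i`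
may vanish. -/
theorem hasSum_norm_sq_of_orthogonal {F : Type*} [NormedAddCommGroup F] [InnerProductSpace ℝ F]
    [CompleteSpace F] {g : ℕ → F} (hg : Pairwise fun i j => inner ℝ (g i) (g j) = 0)
    (hs : Summable fun i => ‖g i‖ ^ 2) :
    Summable g ∧ HasSum (fun i => ‖g i‖ ^ 2) (‖∑' i, g i‖ ^ 2) := by
  have hV : OrthogonalFamily ℝ (fun i => Submodule.span ℝ {g i})
      fun i => (Submodule.span ℝ {g i}).subtypeₗᵢ := by
    intro i j hij v w
    obtain ⟨a, ha⟩ := Submodule.mem_span_singleton.1 v.2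
    obtain ⟨b, hb⟩ := Submodule.mem_span_singleton.1 w.2
    change inner ℝ (v : F) (w : F) = 0
    rw [← ha, ← hb, inner_smul_left, inner_smul_right, hg hij, mul_zero, mul_zero]
  let f : ∀ i, Submodule.span ℝ {g i} := fun i => ⟨g i, Submodule.mem_span_singleton_self _⟩
  have hsum : Summable g := (hV.summable_iff_norm_sq_summable f).2 hs
  refine ⟨hsum, ?_⟩
  have h1 : Tendsto (fun s : Finset ℕ => ‖∑ i ∈ s, g i‖ ^ 2) atTop (𝓝 (‖∑' i, g i‖ ^ 2)) :=
    (hsum.hasSum.norm).pow 2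
  exact h1.congr fun s => hV.norm_sum f s

/-! ### Weak derivatives -/

section Weak

variable {d : ℕ} {Ω : Set (E d)} {j : Fin d}

theorem IsTestFunction.memLp {ψ : E d → ℝ} (hψ : IsTestFunction Ω ψ) :
    MemLp ψ 2 (volume.restrict Ω) :=
  (hψ.1.continuous.memLp_of_hasCompactSupport hψ.2.1).restrict Ω

theorem IsTestFunction.memLp_partialDeriv {ψ : E d → ℝ} (hψ : IsTestFunction Ω ψ) (j : Fin d) :
    MemLp (partialDeriv j ψ) 2 (volume.restrict Ω) := by
  refine (Continuous.memLp_of_hasCompactSupport ?_ ?_).restrict Ω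
  · exact (hψ.1.continuous_fderiv (by simp)).clm_apply continuous_const
  · exact (hψ.2.1.fderiv ℝ).comp_left (g := fun L : E d →L[ℝ] ℝ => L (EuclideanSpace.single j 1)) rfl

theorem integral_mul_eq_inner (u : L2 Ω) {f : E d → ℝ} (hf : MemLp f 2 (volume.restrict Ω)) :
    ∫ x in Ω, u x * f x = inner ℝ u (hf.toLp f) := by
  rw [L2.inner_def]
  refine integral_congr_ae ?_
  filter_upwards [hf.coeFn_toLp] with x hx
  simp [hx, mul_comm]

theorem isWeakPartialDeriv_iff {u g : L2 Ω} : IsWeakPartialDeriv Ω j u g ↔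
    ∀ (ψ : E d → ℝ) (hψ : IsTestFunction Ω ψ),
      inner ℝ u ((hψ.memLp_partialDeriv j).toLp _) = - inner ℝ g (hψ.memLp.toLp ψ) := by
  refine forall₂_congr fun ψ hψ => ?_
  rw [integral_mul_eq_inner, integral_mul_eq_inner]

theorem IsWeakPartialDeriv.sub {u g v h : L2 Ω} (hu : IsWeakPartialDeriv Ω j u g)
    (hv : IsWeakPartialDeriv Ω j v h) : IsWeakPartialDeriv Ω j (u - v) (g - h) := by
  rw [isWeakPartialDeriv_iff] at *
  intro ψ hψ
  rw [inner_sub_left, inner_sub_left, hu ψ hψ, hv ψ hψ]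
  ring

/-- The weak derivative is a closed operator: against a fixed test function, both sides are
continuous linear functionals on `L²`. -/
theorem IsWeakPartialDeriv.hasSum_smul {u g : ℕ → L2 Ω} {v h : L2 Ω} (c : ℕ → ℝ)
    (hu : ∀ k, IsWeakPartialDeriv Ω j (u k) (g k)) (hv : HasSum (fun k => c k • u k) v)
    (hh : HasSum (fun k => c k • g k) h) : IsWeakPartialDeriv Ω j v h := by
  rw [isWeakPartialDeriv_iff]
  intro ψ hψ
  have h1 := hv.mapL (innerSL ℝ ((hψ.memLp_partialDeriv j).toLp (partialDeriv j ψ)))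
  have h2 := (hh.mapL (innerSL ℝ (hψ.memLp.toLp ψ))).neg
  simp only [innerSL_apply_apply, inner_smul_right] at h1 h2
  rw [real_inner_comm, real_inner_comm _ h]
  refine h1.unique (h2.congr_fun fun k => ?_)
  rw [real_inner_comm, isWeakPartialDeriv_iff.1 (hu k) ψ hψ, real_inner_comm]
  ring

theorem weakPartialDeriv_spec {u : L2 Ω} (h : ∃ g, IsWeakPartialDeriv Ω j u g) :
    IsWeakPartialDeriv Ω j u (weakPartialDeriv Ω j u) := by
  rw [weakPartialDeriv, dif_pos h]
  exact h.choose_spec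

theorem IsWeakPartialDeriv.eq (hΩ : IsOpen Ω) {u g : L2 Ω} (h : IsWeakPartialDeriv Ω j u g) :
    weakPartialDeriv Ω j u = g :=
  (weakPartialDeriv_spec ⟨g, h⟩).unique hΩ h

/-- `u ∈ H^1(Ω)`. -/
def MemH1 {d : ℕ} (Ω : Set (E d)) (u : L2 Ω) : Prop :=
  ∀ j, ∃ g, IsWeakPartialDeriv Ω j u g

/-- The weak gradient, as an element of `L²(Ω)^d`. -/
noncomputable def weakGrad {d : ℕ} (Ω : Set (E d)) (u : L2 Ω) : PiLp 2 fun _ : Fin d => L2 Ω :=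
  WithLp.toLp 2 fun j => weakPartialDeriv Ω j u

theorem weakGrad_sub (hΩ : IsOpen Ω) {u v : L2 Ω} (hu : MemH1 Ω u) (hv : MemH1 Ω v) :
    weakGrad Ω (u - v) = weakGrad Ω u - weakGrad Ω v := by
  ext1 j
  exact ((weakPartialDeriv_spec (hu j)).sub (weakPartialDeriv_spec (hv j))).eq hΩ

theorem advection_sub (hΩ : IsOpen Ω) (η : E d) {u v : L2 Ω} (hu : MemH1 Ω u) (hv : MemH1 Ω v) :
    advection η (u - v) = advection η u - advection η v := by
  rw [advection, advection, advection, ← Finset.sum_sub_distrib]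
  refine Finset.sum_congr rfl fun j _ => ?_
  rw [((weakPartialDeriv_spec (hu j)).sub (weakPartialDeriv_spec (hv j))).eq hΩ, smul_sub]

theorem norm_advection_le (η : E d) (u : L2 Ω) : ‖advection η u‖ ≤ ‖η‖ * ‖weakGrad Ω u‖ := by
  rw [EuclideanSpace.norm_eq, PiLp.norm_eq_of_L2]
  refine (norm_sum_le _ _).trans ?_
  simp only [norm_smul]
  exact Real.sum_mul_le_sqrt_mul_sqrt _ _ _

end Weak

/-! ### The Hilbert scale -/

section Spectral

variable {d : ℕ} {Ω : Set (E d)} {θ : ℕ → ℝ} {φ : HilbertBasis ℕ ℝ (L2 Ω)}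

theorem inner_weakGrad (hφ : IsDirichletEigenbasis Ω θ φ) (i k : ℕ) :
    inner ℝ (weakGrad Ω (φ i)) (weakGrad Ω (φ k)) = θ i * inner ℝ (φ i) (φ k) := by
  rw [PiLp.inner_apply]
  exact (hφ.2 i).2 _ (hφ.2 k).1

theorem norm_sq_weakGrad (hφ : IsDirichletEigenbasis Ω θ φ) (k : ℕ) :
    ‖weakGrad Ω (φ k)‖ ^ 2 = θ k := by
  rw [← real_inner_self_eq_norm_sq, inner_weakGrad hφ, real_inner_self_eq_norm_sq,
    φ.orthonormal.1 k]
  simp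

theorem IsDirichletEigenbasis.nonneg (hφ : IsDirichletEigenbasis Ω θ φ) (k : ℕ) : 0 ≤ θ k := by
  rw [← norm_sq_weakGrad hφ]; positivity

theorem hasSum_inner_smul (φ : HilbertBasis ℕ ℝ (L2 Ω)) (w : L2 Ω) :
    HasSum (fun k => (inner ℝ w (φ k) : ℝ) • φ k) w := by
  simpa only [φ.repr_apply_apply, real_inner_comm] using φ.hasSum_repr w

theorem hasSum_inner_sq (φ : HilbertBasis ℕ ℝ (L2 Ω)) (w : L2 Ω) :
    HasSum (fun k => (inner ℝ w (φ k) : ℝ) ^ 2) (‖w‖ ^ 2) := by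
  rw [← real_inner_self_eq_norm_sq]
  refine (φ.hasSum_inner_mul_inner w w).congr_fun fun k => ?_
  rw [real_inner_comm w, sq]

/-- The gradients of the `φ k` are orthogonal with squared norms `θ k`, so the gradient series of
`w` converges in `L²(Ω)^d`. Closedness of the weak derivative identifies its sum, and Pythagoras
gives the norm. -/
theorem memH1_and_norm_weakGrad (hΩ : IsOpen Ω) (hφ : IsDirichletEigenbasis Ω θ φ) {w : L2 Ω}
    (hw : MemD θ φ 1 w) : MemH1 Ω w ∧ ‖weakGrad Ω w‖ = normD θ φ 1 w := by
  set c : ℕ → ℝ := fun k => inner ℝ w (φ k)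
  have hsq : ∀ k, ‖c k • weakGrad Ω (φ k)‖ ^ 2 = θ k ^ (1 : ℝ) * c k ^ 2 := fun k => by
    rw [norm_smul, mul_pow, norm_sq_weakGrad hφ, Real.rpow_one, Real.norm_eq_abs, sq_abs, mul_comm]
  obtain ⟨hs, hn⟩ := hasSum_norm_sq_of_orthogonal (g := fun k => c k • weakGrad Ω (φ k))
    (fun i k hik => by
      beta_reduce
      rw [inner_smul_left, inner_smul_right, inner_weakGrad hφ, φ.orthonormal.2 hik]; simp)
    (by simpa only [hsq] using (show Summable fun k => θ k ^ (1 : ℝ) * c k ^ 2 from hw))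
  have hweak : ∀ j, IsWeakPartialDeriv Ω j w ((∑' k, c k • weakGrad Ω (φ k)).ofLp j) := fun j =>
    .hasSum_smul c (fun k => weakPartialDeriv_spec ((hφ.2 k).1.1 j)) (hasSum_inner_smul φ w)
      (hs.hasSum.mapL (PiLp.proj (𝕜 := ℝ) 2 (fun _ : Fin d => L2 Ω) j))
  have hgrad : weakGrad Ω w = ∑' k, c k • weakGrad Ω (φ k) := by
    ext1 j
    exact (hweak j).eq hΩ
  refine ⟨fun j => ⟨_, hweak j⟩, ?_⟩
  simp only [hsq] at hn
  rw [hgrad, normD, hn.tsum_eq, Real.sqrt_sq (norm_nonneg _)]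

theorem MemD.sub (hθ : ∀ k, 0 ≤ θ k) {ν : ℝ} {u v : L2 Ω} (hu : MemD θ φ ν u)
    (hv : MemD θ φ ν v) : MemD θ φ ν (u - v) := by
  refine .of_nonneg_of_le (fun k => ?_) (fun k => ?_) ((hu.add hv).mul_left 2)
  · have := Real.rpow_nonneg (hθ k) ν; positivity
  · rw [inner_sub_left]
    nlinarith [mul_nonneg (Real.rpow_nonneg (hθ k) ν)
      (sq_nonneg ((inner ℝ u (φ k) : ℝ) + inner ℝ v (φ k)))]

theorem normD_le_of_sum_le (hθ : ∀ k, 0 ≤ θ k) {w : L2 Ω} {B : ℝ} (hB : 0 ≤ B)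
    (h : ∀ s : Finset ℕ, ∑ k ∈ s, θ k * (inner ℝ w (φ k)) ^ 2 ≤ B ^ 2) :
    normD θ φ 1 w ≤ B := by
  rw [normD]
  simp only [Real.rpow_one]
  refine Real.sqrt_le_iff.2 ⟨hB, ?_⟩
  exact Real.tsum_le_of_sum_le (fun k => mul_nonneg (hθ k) (sq_nonneg _)) h

theorem normD_sq (hθ : ∀ k, 0 ≤ θ k) (w : L2 Ω) :
    normD θ φ 1 w ^ 2 = ∑' k, θ k * (inner ℝ w (φ k)) ^ 2 := by
  simp only [normD, Real.rpow_one]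
  exact Real.sq_sqrt (tsum_nonneg fun k => mul_nonneg (hθ k) (sq_nonneg _))

theorem memD_one_iff {w : L2 Ω} :
    MemD θ φ 1 w ↔ Summable fun k => θ k * (inner ℝ w (φ k)) ^ 2 := by
  simp only [MemD, Real.rpow_one]

/-- The operator that multiplies the `k`-th Fourier coefficient by `m k`. -/
noncomputable def spectralMultiplier (φ : HilbertBasis ℕ ℝ (L2 Ω)) (m : ℕ → ℝ) (w : L2 Ω) : L2 Ω :=
  ∑' k, (m k * inner ℝ w (φ k)) • φ k

/-- Boundedness of `m` keeps the coefficients square-summable, so that the `tsum` is a genuine sum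
and not the default value `0`. -/
theorem inner_spectralMultiplier {m : ℕ → ℝ} {B : ℝ} (hm : ∀ k, |m k| ≤ B) (w : L2 Ω) (k : ℕ) :
    inner ℝ (spectralMultiplier φ m w) (φ k) = m k * inner ℝ w (φ k) := by
  have hmem : Memℓp (fun k => m k * (inner ℝ w (φ k) : ℝ)) 2 := by
    refine memℓp_gen ?_
    refine .of_nonneg_of_le (fun k => by positivity) (fun k => ?_)
      ((hasSum_inner_sq φ w).summable.mul_left (B ^ 2))
    have h2 : ((2 : ℝ≥0∞).toReal) = ((2 : ℕ) : ℝ) := by norm_num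
    rw [h2, Real.rpow_natCast, norm_mul, mul_pow, Real.norm_eq_abs, Real.norm_eq_abs,
      sq_abs (inner ℝ w (φ k))]
    gcongr
    exact hm k
  have h := (φ.hasSum_repr_symm ⟨_, hmem⟩).tsum_eq
  change spectralMultiplier φ m w = _ at h
  rw [h, real_inner_comm, ← φ.repr_apply_apply, LinearIsometryEquiv.apply_symm_apply]

theorem ext_inner_basis {u v : L2 Ω} (h : ∀ k, (inner ℝ u (φ k) : ℝ) = inner ℝ v (φ k)) :
    u = v := by
  rw [← (hasSum_inner_smul φ u).tsum_eq, ← (hasSum_inner_smul φ v).tsum_eq]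
  simp only [h]

theorem spectralMultiplier_sub {m : ℕ → ℝ} {B : ℝ} (hm : ∀ k, |m k| ≤ B) (u v : L2 Ω) :
    spectralMultiplier φ m (u - v) = spectralMultiplier φ m u - spectralMultiplier φ m v :=
  ext_inner_basis (φ := φ) fun k => by
    simp only [inner_sub_left, inner_spectralMultiplier hm]; ring

theorem normD_spectralMultiplier_le (hθ : ∀ k, 0 ≤ θ k) {m : ℕ → ℝ} {B : ℝ}
    (hm : ∀ k, |m k| ≤ B) {w : L2 Ω} (hw : MemD θ φ 1 w) :
    MemD θ φ 1 (spectralMultiplier φ m w) ∧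
      normD θ φ 1 (spectralMultiplier φ m w) ≤ B * normD θ φ 1 w := by
  have hB : 0 ≤ B := (abs_nonneg _).trans (hm 0)
  rw [memD_one_iff] at *
  have hle : ∀ k, θ k * (inner ℝ (spectralMultiplier φ m w) (φ k)) ^ 2 ≤
      B ^ 2 * (θ k * (inner ℝ w (φ k)) ^ 2) := fun k => by
    rw [inner_spectralMultiplier hm, mul_pow, mul_left_comm]
    refine mul_le_mul_of_nonneg_right (sq_le_sq' ?_ ?_) (mul_nonneg (hθ k) (sq_nonneg _))
    · exact (abs_le.1 (hm k)).1
    · exact (abs_le.1 (hm k)).2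
  refine ⟨.of_nonneg_of_le (fun k => mul_nonneg (hθ k) (sq_nonneg _)) hle (hw.mul_left _), ?_⟩
  refine normD_le_of_sum_le hθ (mul_nonneg hB (Real.sqrt_nonneg _)) fun s => ?_
  rw [mul_pow, normD_sq hθ, ← tsum_mul_left]
  exact (Finset.sum_le_sum fun k _ => hle k).trans
    ((hw.mul_left _).sum_le_tsum s fun k _ =>
      mul_nonneg (sq_nonneg _) (mul_nonneg (hθ k) (sq_nonneg _)))

/-- The smoothing step from `L²` to `D^1`: the weight `θ k` is absorbed by `θ k ≤ (1 + θ k) ^ 2`. -/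
theorem normD_spectralMultiplier_le_norm (hθ : ∀ k, 0 ≤ θ k) {m : ℕ → ℝ} {B : ℝ}
    (hm : ∀ k, |m k| ≤ B / (1 + θ k)) (w : L2 Ω) :
    MemD θ φ 1 (spectralMultiplier φ m w) ∧
      normD θ φ 1 (spectralMultiplier φ m w) ≤ B * ‖w‖ := by
  have hB : 0 ≤ B := by
    have := (abs_nonneg _).trans (hm 0)
    rwa [le_div_iff₀ (by linarith [hθ 0]), zero_mul] at this
  have hm' : ∀ k, |m k| ≤ B := fun k =>
    (hm k).trans (div_le_self hB (by linarith [hθ k]))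
  have hw := (hasSum_inner_sq φ w).mul_left (B ^ 2)
  have hle : ∀ k, θ k * (inner ℝ (spectralMultiplier φ m w) (φ k)) ^ 2 ≤
      B ^ 2 * (inner ℝ w (φ k)) ^ 2 := fun k => by
    rw [inner_spectralMultiplier hm', mul_pow, ← mul_assoc]
    refine mul_le_mul_of_nonneg_right ?_ (sq_nonneg _)
    have h1 : 0 < 1 + θ k := by linarith [hθ k]
    calc θ k * m k ^ 2 ≤ (1 + θ k) ^ 2 * |m k| ^ 2 := by
          rw [sq_abs]
          exact mul_le_mul_of_nonneg_right (by nlinarith [hθ k]) (sq_nonneg _)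
      _ = ((1 + θ k) * |m k|) ^ 2 := by ring
      _ ≤ B ^ 2 := by
          have := (le_div_iff₀' h1).1 (hm k)
          gcongr
  rw [memD_one_iff]
  refine ⟨.of_nonneg_of_le (fun k => mul_nonneg (hθ k) (sq_nonneg _)) hle hw.summable, ?_⟩
  refine normD_le_of_sum_le hθ (by positivity) fun s => ?_
  rw [mul_pow]
  exact (Finset.sum_le_sum fun k _ => hle k).trans
    (sum_le_hasSum s (fun k _ => by positivity) hw)

/-- The operator `w ↦ ∑_{k ∈ s} √θₖ ⟨w, φₖ⟩ φₖ`. -/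
noncomputable def truncatedSqrt (θ : ℕ → ℝ) (φ : HilbertBasis ℕ ℝ (L2 Ω)) (s : Finset ℕ) :
    L2 Ω →L[ℝ] L2 Ω :=
  ∑ k ∈ s, √(θ k) • (innerSL ℝ (φ k)).smulRight (φ k)

theorem norm_truncatedSqrt_sq (hθ : ∀ k, 0 ≤ θ k) (s : Finset ℕ) (w : L2 Ω) :
    ‖truncatedSqrt θ φ s w‖ ^ 2 = ∑ k ∈ s, θ k * (inner ℝ w (φ k)) ^ 2 := by
  have h : truncatedSqrt θ φ s w = ∑ k ∈ s, (√(θ k) * inner ℝ w (φ k)) • φ k := by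
    simp only [truncatedSqrt, _root_.sum_apply, _root_.smul_apply,
      ContinuousLinearMap.smulRight_apply, innerSL_apply_apply, smul_smul, real_inner_comm]
  rw [h, ← real_inner_self_eq_norm_sq, φ.orthonormal.inner_sum]
  refine Finset.sum_congr rfl fun k _ => ?_
  rw [conj_trivial, ← sq, mul_pow, Real.sq_sqrt (hθ k)]

theorem norm_truncatedSqrt_le (hθ : ∀ k, 0 ≤ θ k) (s : Finset ℕ) {w : L2 Ω}
    (hw : MemD θ φ 1 w) : ‖truncatedSqrt θ φ s w‖ ≤ normD θ φ 1 w := by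
  refine le_of_sq_le_sq ?_ (Real.sqrt_nonneg _)
  rw [norm_truncatedSqrt_sq hθ, normD_sq hθ]
  exact (memD_one_iff.1 hw).sum_le_tsum s fun k _ => mul_nonneg (hθ k) (sq_nonneg _)

/-- The integral is taken in `L²`, not in `D^1`. Each `truncatedSqrt` is bounded on `L²` and so
commutes with it, and bounds uniform over finite sets of modes pass to the `D^1` norm. -/
theorem normD_add_integral_le (hθ : ∀ k, 0 ≤ θ k) {f : ℝ → L2 Ω} {g : ℝ → ℝ} {v : L2 Ω} {t : ℝ}
    (ht : 0 ≤ t) (hv : MemD θ φ 1 v) (hf : IntervalIntegrable f volume 0 t)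
    (hg : IntervalIntegrable g volume 0 t)
    (hfD : ∀ τ ∈ Set.Ioc 0 t, MemD θ φ 1 (f τ) ∧ normD θ φ 1 (f τ) ≤ g τ) :
    normD θ φ 1 (v + ∫ τ in (0 : ℝ)..t, f τ) ≤ normD θ φ 1 v + ∫ τ in (0 : ℝ)..t, g τ := by
  have hg0 : 0 ≤ ∫ τ in (0 : ℝ)..t, g τ := by
    rw [intervalIntegral.integral_of_le ht]
    exact setIntegral_nonneg measurableSet_Ioc fun τ hτ => (Real.sqrt_nonneg _).trans (hfD τ hτ).2
  refine normD_le_of_sum_le hθ (add_nonneg (Real.sqrt_nonneg _) hg0) fun s => ?_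
  rw [← norm_truncatedSqrt_sq hθ, map_add,
    ← ContinuousLinearMap.intervalIntegral_comp_comm _ hf]
  gcongr
  refine (norm_add_le _ _).trans (add_le_add (norm_truncatedSqrt_le hθ s hv) ?_)
  refine intervalIntegral.norm_integral_le_of_norm_le ht (Eventually.of_forall fun τ hτ => ?_) hg
  exact (norm_truncatedSqrt_le hθ s (hfD τ hτ).1).trans (hfD τ hτ).2

end Spectral

/-! ### Differences of mild solutions -/

section Mild

variable {d : ℕ} {Ω : Set (E d)} {θ : ℕ → ℝ} {φ : HilbertBasis ℕ ℝ (L2 Ω)} {α : ℝ} {η : E d}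
  {I : Set ℝ} {u₀ w₀ : L2 Ω} {u w : ℝ → L2 Ω}

theorem abs_neg_mul_rpow_div_le {a t : ℝ} (ha : 0 ≤ a) (ht : 0 ≤ t) :
    |-a * t ^ α / (1 + a)| ≤ t ^ α := by
  have h : 0 ≤ t ^ α := Real.rpow_nonneg ht α
  rw [abs_div, abs_mul, abs_neg, abs_of_nonneg ha, abs_of_nonneg h,
    abs_of_pos (by linarith : (0 : ℝ) < 1 + a), div_le_iff₀ (by linarith)]
  nlinarith

theorem abs_opR_coeff_le {M : ℝ}
    (hM : ∀ t z : ℝ, 0 ≤ t → |z| ≤ t ^ α → |mittagLeffler α α z| ≤ M * Real.exp (2 * t))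
    {a s : ℝ} (ha : 0 ≤ a) (hs : 0 ≤ s) :
    |s ^ (α - 1) / (1 + a) * mittagLeffler α α (-a * s ^ α / (1 + a))| ≤
      s ^ (α - 1) * (M * Real.exp (2 * s)) / (1 + a) := by
  have h1 : 0 ≤ s ^ (α - 1) / (1 + a) := by positivity
  rw [abs_mul, abs_of_nonneg h1]
  refine (mul_le_mul_of_nonneg_left (hM s _ hs (abs_neg_mul_rpow_div_le ha hs)) h1).trans ?_
  rw [mul_div_right_comm]

/-- This turns continuity in `normD` into continuity in a normed space, from which the weighted norm
of a difference attains its maximum. -/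
theorem ContinuousOnD.continuousOn_weakGrad (hΩ : IsOpen Ω) (hφ : IsDirichletEigenbasis Ω θ φ)
    (hu : ContinuousOnD θ φ 1 I u) : ContinuousOn (fun t => weakGrad Ω (u t)) I := by
  intro t ht
  rw [ContinuousWithinAt, tendsto_iff_norm_sub_tendsto_zero]
  refine (hu.2 t ht).congr' ?_
  filter_upwards [self_mem_nhdsWithin] with s hs
  rw [← weakGrad_sub hΩ (memH1_and_norm_weakGrad hΩ hφ (hu.1 s hs)).1
    (memH1_and_norm_weakGrad hΩ hφ (hu.1 t ht)).1,
    (memH1_and_norm_weakGrad hΩ hφ ((hu.1 s hs).sub hφ.nonneg (hu.1 t ht))).2]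

theorem IsTimeInterval.mem_of_mem_Icc (hI : IsTimeInterval I) {s t : ℝ} (ht : t ∈ I)
    (hs : s ∈ Set.Icc 0 t) : s ∈ I :=
  hI.2.2.out hI.1 ht hs

theorem IsMildSolution.sub_eq (hΩ : IsOpen Ω) (hφ : IsDirichletEigenbasis Ω θ φ) (hα : 0 < α)
    (hI : IsTimeInterval I) (hu : IsMildSolution θ φ α η I u₀ u)
    (hw : IsMildSolution θ φ α η I w₀ w) {t : ℝ} (ht : t ∈ I) :
    IntervalIntegrable (fun τ => opR θ φ α (t - τ) (advection η (u τ - w τ))) volume 0 t ∧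
      u t - w t = opS θ φ α t (u₀ - w₀) +
        ∫ τ in (0 : ℝ)..t, opR θ φ α (t - τ) (advection η (u τ - w τ)) := by
  have ht0 : 0 ≤ t := hI.2.1 ht
  obtain ⟨M₁, -, hM₁⟩ := exists_abs_mittagLeffler_le hα one_pos
  obtain ⟨M₂, hM₂p, hM₂⟩ := exists_abs_mittagLeffler_le hα hα
  -- `opS` and `opR` are instances of `spectralMultiplier` by definition.
  have hS : opS θ φ α t (u₀ - w₀) = opS θ φ α t u₀ - opS θ φ α t w₀ :=
    spectralMultiplier_sub (fun k => hM₁ t _ ht0 (abs_neg_mul_rpow_div_le (hφ.nonneg k) ht0)) u₀ w₀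
  have hR : Set.EqOn (fun τ => opR θ φ α (t - τ) (advection η (u τ)) -
      opR θ φ α (t - τ) (advection η (w τ)))
      (fun τ => opR θ φ α (t - τ) (advection η (u τ - w τ))) (Set.uIcc 0 t) := fun τ hτ => by
    rw [Set.uIcc_of_le ht0] at hτ
    have hτI := hI.mem_of_mem_Icc ht hτ
    have hs : 0 ≤ t - τ := sub_nonneg.2 hτ.2
    beta_reduce
    rw [advection_sub hΩ η (memH1_and_norm_weakGrad hΩ hφ (hu.1.1 τ hτI)).1
      (memH1_and_norm_weakGrad hΩ hφ (hw.1.1 τ hτI)).1]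
    exact (spectralMultiplier_sub (fun k => (abs_opR_coeff_le hM₂ (hφ.nonneg k) hs).trans
      (div_le_self (by positivity) (by linarith [hφ.nonneg k]))) _ _).symm
  obtain ⟨hui, hue⟩ := hu.2 t ht
  obtain ⟨hwi, hwe⟩ := hw.2 t ht
  refine ⟨(hui.sub hwi).congr (hR.mono Set.uIoc_subset_uIcc), ?_⟩
  rw [← intervalIntegral.integral_congr hR, intervalIntegral.integral_sub hui hwi, hS]
  nth_rw 1 [hue, hwe]
  abel

theorem exists_normD_sub_le (hΩ : IsOpen Ω) (hφ : IsDirichletEigenbasis Ω θ φ) (hα : 0 < α) :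
    ∃ M > 0, ∀ η : E d, ∃ σ > 0, ∀ I : Set ℝ, IsTimeInterval I →
      ∀ (u₀ w₀ : L2 Ω) (u w : ℝ → L2 Ω), MemD θ φ 1 u₀ → MemD θ φ 1 w₀ →
        IsMildSolution θ φ α η I u₀ u → IsMildSolution θ φ α η I w₀ w →
          ∀ t ∈ I, normD θ φ 1 (u t - w t) ≤ M * Real.exp (σ * t) * normD θ φ 1 (u₀ - w₀) := by
  obtain ⟨M₁, hM₁p, hM₁⟩ := exists_abs_mittagLeffler_le hα one_pos
  obtain ⟨M₂, hM₂p, hM₂⟩ := exists_abs_mittagLeffler_le hα hα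
  refine ⟨2 * M₁, by positivity, fun η => ?_⟩
  -- Only `r` depends on `η`. In the rate `r + 2`, the `2` pays for the growth `exp (2 * t)` of the
  -- kernels and `r` for the contraction.
  obtain ⟨r, hr, hrA⟩ := exists_const_mul_rpow_inv_le_half hα (M₂ * ‖η‖ * Real.Gamma α)
  refine ⟨r + 2, by positivity, fun I hI u₀ w₀ u w hu₀ hw₀ hu hw T hT => ?_⟩
  have hT0 : 0 ≤ T := hI.2.1 hT
  have hD : ∀ τ ∈ Set.Icc 0 T, MemD θ φ 1 (u τ - w τ) := fun τ hτ =>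
    (hu.1.1 τ (hI.mem_of_mem_Icc hT hτ)).sub hφ.nonneg (hw.1.1 τ (hI.mem_of_mem_Icc hT hτ))
  have hcont : ContinuousOn
      (fun τ => Real.exp (-((r + 2) * τ)) * normD θ φ 1 (u τ - w τ)) (Set.Icc 0 T) := by
    refine ContinuousOn.mul (by fun_prop) ?_
    have hsub : Set.Icc 0 T ⊆ I := fun τ hτ => hI.mem_of_mem_Icc hT hτ
    refine (((hu.1.continuousOn_weakGrad hΩ hφ).mono hsub).sub
      ((hw.1.continuousOn_weakGrad hΩ hφ).mono hsub)).norm.congr fun τ hτ => ?_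
    rw [← (memH1_and_norm_weakGrad hΩ hφ (hD τ hτ)).2,
      weakGrad_sub hΩ (memH1_and_norm_weakGrad hΩ hφ (hu.1.1 τ (hsub hτ))).1
        (memH1_and_norm_weakGrad hΩ hφ (hw.1.1 τ (hsub hτ))).1]
    rfl
  -- The mild equation is estimated at the maximum point `t` of the weighted norm, where it bounds
  -- `Y` by itself.
  obtain ⟨t, ht, hmax⟩ := isCompact_Icc.exists_isMaxOn (Set.nonempty_Icc.2 hT0) hcont
  set Y := Real.exp (-((r + 2) * t)) * normD θ φ 1 (u t - w t) with hY
  set N := normD θ φ 1 (u₀ - w₀)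
  have hN : 0 ≤ N := Real.sqrt_nonneg _
  have hY0 : 0 ≤ Y := mul_nonneg (Real.exp_pos _).le (Real.sqrt_nonneg _)
  have hbound : ∀ τ ∈ Set.Icc 0 T, normD θ φ 1 (u τ - w τ) ≤ Y * Real.exp ((r + 2) * τ) :=
    fun τ hτ => by
      have h := mul_le_mul_of_nonneg_right (hmax hτ) (Real.exp_pos ((r + 2) * τ)).le
      rwa [mul_right_comm, ← Real.exp_add, neg_add_cancel, Real.exp_zero, one_mul] at h
  have htI := hI.mem_of_mem_Icc hT ht
  obtain ⟨hint, heq⟩ := hu.sub_eq hΩ hφ hα hI hw htI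
  obtain ⟨hSD, hSn⟩ := normD_spectralMultiplier_le hφ.nonneg
    (fun k => hM₁ t _ ht.1 (abs_neg_mul_rpow_div_le (hφ.nonneg k) ht.1)) (hu₀.sub hφ.nonneg hw₀)
  obtain ⟨hgi, hgn⟩ := integral_rpow_mul_exp_neg_le hα hr ht.1
  have hstep := normD_add_integral_le (g := fun τ => M₂ * ‖η‖ * Y * Real.exp ((r + 2) * t) *
      ((t - τ) ^ (α - 1) * Real.exp (-(r * (t - τ))))) hφ.nonneg ht.1 hSD hint
    (hgi.const_mul _) fun τ hτ => by
      have hs : 0 ≤ t - τ := sub_nonneg.2 hτ.2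
      have hτT : τ ∈ Set.Icc 0 T := ⟨hτ.1.le, hτ.2.trans ht.2⟩
      obtain ⟨hRD, hRn⟩ := normD_spectralMultiplier_le_norm hφ.nonneg
        (fun k => abs_opR_coeff_le hM₂ (hφ.nonneg k) hs) (advection η (u τ - w τ))
      refine ⟨hRD, hRn.trans ?_⟩
      have hadv : ‖advection η (u τ - w τ)‖ ≤ ‖η‖ * (Y * Real.exp ((r + 2) * τ)) :=
        (norm_advection_le η _).trans <| by
          rw [(memH1_and_norm_weakGrad hΩ hφ (hD τ hτT)).2]
          exact mul_le_mul_of_nonneg_left (hbound τ hτT) (norm_nonneg _)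
      refine (mul_le_mul_of_nonneg_left hadv (by positivity)).trans (le_of_eq ?_)
      have he : Real.exp (2 * (t - τ)) * Real.exp ((r + 2) * τ) =
          Real.exp ((r + 2) * t) * Real.exp (-(r * (t - τ))) := by
        rw [← Real.exp_add, ← Real.exp_add]; ring_nf
      linear_combination (t - τ) ^ (α - 1) * M₂ * ‖η‖ * Y * he
  rw [intervalIntegral.integral_const_mul] at hstep
  -- The choice of `r` gives the factor `1/2`; since `Y` is finite, `Y ≤ 2 * M₁ * N` follows.
  have hYle : Y ≤ M₁ * N + Y / 2 := by
    have he : Real.exp (-((r + 2) * t)) * Real.exp ((r + 2) * t) = 1 := by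
      rw [← Real.exp_add, neg_add_cancel, Real.exp_zero]
    have h2 : Real.exp (2 * t) ≤ Real.exp ((r + 2) * t) :=
      Real.exp_le_exp.2 (by nlinarith [mul_nonneg hr.le ht.1])
    have h3 : normD θ φ 1 (u t - w t) ≤ Real.exp ((r + 2) * t) * (M₁ * N + Y / 2) := by
      rw [heq]
      refine hstep.trans ?_
      calc _ ≤ M₁ * Real.exp (2 * t) * N + M₂ * ‖η‖ * Y * Real.exp ((r + 2) * t) *
            ((1 / r) ^ α * Real.Gamma α) := by gcongr
        _ = M₁ * Real.exp (2 * t) * N + Y * Real.exp ((r + 2) * t) *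
            (M₂ * ‖η‖ * Real.Gamma α * (1 / r) ^ α) := by ring
        _ ≤ M₁ * Real.exp ((r + 2) * t) * N + Y * Real.exp ((r + 2) * t) * (1 / 2) := by gcongr
        _ = _ := by ring
    calc Y ≤ Real.exp (-((r + 2) * t)) * (Real.exp ((r + 2) * t) * (M₁ * N + Y / 2)) :=
          mul_le_mul_of_nonneg_left h3 (Real.exp_pos _).le
      _ = M₁ * N + Y / 2 := by rw [← mul_assoc, he, one_mul]
  refine (hbound T (Set.right_mem_Icc.2 hT0)).trans ?_
  calc Y * Real.exp ((r + 2) * T) ≤ (2 * M₁ * N) * Real.exp ((r + 2) * T) := by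
        gcongr; linarith
    _ = _ := by ring

theorem opR_zero (t : ℝ) : opR θ φ α t 0 = 0 := by simp [opR]

theorem normD_zero : normD θ φ 1 (0 : L2 Ω) = 0 := by simp [normD]

/-- Positivity of the eigenvalues is not needed to pass from zero `D^1` norm to equality: the
gradient of `u - w` vanishes, hence so does the source, and the mild equation with zero data gives
`u t - w t = 0`. -/
theorem IsMildSolution.eq_of_normD_sub_eq_zero (hΩ : IsOpen Ω) (hφ : IsDirichletEigenbasis Ω θ φ)
    (hα : 0 < α) (hI : IsTimeInterval I) (hu : IsMildSolution θ φ α η I u₀ u)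
    (hw : IsMildSolution θ φ α η I u₀ w) (h : ∀ t ∈ I, normD θ φ 1 (u t - w t) = 0)
    {t : ℝ} (ht : t ∈ I) : u t = w t := by
  have ht0 : 0 ≤ t := hI.2.1 ht
  have hR : Set.EqOn (fun τ => opR θ φ α (t - τ) (advection η (u τ - w τ))) (fun _ => 0)
      (Set.uIcc 0 t) := fun τ hτ => by
    rw [Set.uIcc_of_le ht0] at hτ
    have hτI := hI.mem_of_mem_Icc ht hτ
    have hz : advection η (u τ - w τ) = 0 := by
      rw [← norm_le_zero_iff]
      refine (norm_advection_le η _).trans ?_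
      rw [(memH1_and_norm_weakGrad hΩ hφ ((hu.1.1 τ hτI).sub hφ.nonneg (hw.1.1 τ hτI))).2, h τ hτI,
        mul_zero]
    beta_reduce
    rw [hz, opR_zero]
  rw [← sub_eq_zero, (hu.sub_eq hΩ hφ hα hI hw ht).2, intervalIntegral.integral_congr hR]
  simp [opS]

end Mild

theorem rpow_le_exp {α t : ℝ} (hα : α ∈ Set.Ioo (0 : ℝ) 1) (ht : 0 ≤ t) :
    t ^ α ≤ Real.exp t :=
  calc t ^ α ≤ (t + 1) ^ α := Real.rpow_le_rpow ht (by linarith) hα.1.le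
    _ ≤ (t + 1) ^ (1 : ℝ) := Real.rpow_le_rpow_of_exponent_le (by linarith) hα.2.le
    _ = t + 1 := Real.rpow_one _
    _ ≤ Real.exp t := Real.add_one_le_exp t

end FracSobolevGalpern

open FracSobolevGalpern
theorem mainTheorem2 (d : ℕ) (hd : 1 ≤ d) (Ω : Set (E d))
    (hΩo : IsOpen Ω) (hΩc : IsConnected Ω) (hΩb : Bornology.IsBounded Ω)
    (θ : ℕ → ℝ) (φ : HilbertBasis ℕ ℝ (L2 Ω)) (hφ : IsDirichletEigenbasis Ω θ φ)
    (α : ℝ) (hα : α ∈ Set.Ioo (0 : ℝ) 1) :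
    -- global uniqueness
    (∀ (η : E d) (I : Set ℝ), IsTimeInterval I →
      ∀ (u₀ : L2 Ω) (u w : ℝ → L2 Ω), MemD θ φ 1 u₀ →
        IsMildSolution θ φ α η I u₀ u → IsMildSolution θ φ α η I u₀ w →
          ∀ t ∈ I, u t = w t) ∧
    -- continuous dependence on the initial data, uniformly on compact time intervals
    (∀ (η : E d) (I : Set ℝ), IsTimeInterval I →
      ∀ (u₀ : L2 Ω) (u : ℝ → L2 Ω), MemD θ φ 1 u₀ → IsMildSolution θ φ α η I u₀ u →
        ∀ T > 0, ∀ ε > 0, ∃ δ > 0, ∀ (w₀ : L2 Ω) (w : ℝ → L2 Ω), MemD θ φ 1 w₀ →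
          IsMildSolution θ φ α η I w₀ w → normD θ φ 1 (u₀ - w₀) < δ →
            ∀ t ∈ I, t ≤ T → normD θ φ 1 (u t - w t) < ε) ∧
    -- the weighted stability estimate
    (∃ C > 0, ∀ η : E d, ∃ σ > 0, ∀ I : Set ℝ, IsTimeInterval I →
      ∀ (u₀ w₀ : L2 Ω) (u w : ℝ → L2 Ω), MemD θ φ 1 u₀ → MemD θ φ 1 w₀ →
        IsMildSolution θ φ α η I u₀ u → IsMildSolution θ φ α η I w₀ w →
          ∀ t ∈ I, t ^ α * Real.exp (-σ * t) * normD θ φ 1 (u t - w t) ≤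
            C * normD θ φ 1 (u₀ - w₀) *
              mittagLeffler α 1 (3 * Real.Gamma α / 4 * t ^ α)) := by
  obtain ⟨M, hM, hmain⟩ := exists_normD_sub_le hΩo hφ hα.1
  refine ⟨fun η I hI u₀ u w hu₀ hu hw t ht => ?_, fun η I hI u₀ u hu₀ hu T hT ε hε => ?_,
    M, hM, fun η => ?_⟩
  · obtain ⟨σ, -, h⟩ := hmain η
    refine hu.eq_of_normD_sub_eq_zero hΩo hφ hα.1 hI hw (fun s hs => ?_) ht
    refine le_antisymm ?_ (Real.sqrt_nonneg _)
    simpa [normD_zero] using h I hI u₀ u₀ u w hu₀ hu₀ hu hw s hs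
  · obtain ⟨σ, hσ, h⟩ := hmain η
    have hp : 0 < M * Real.exp (σ * T) := by positivity
    refine ⟨ε / (M * Real.exp (σ * T)), by positivity, fun w₀ w hw₀ hw hδ t ht htT => ?_⟩
    calc normD θ φ 1 (u t - w t) ≤ M * Real.exp (σ * t) * normD θ φ 1 (u₀ - w₀) :=
          h I hI u₀ w₀ u w hu₀ hw₀ hu hw t ht
      _ ≤ M * Real.exp (σ * T) * normD θ φ 1 (u₀ - w₀) := by
          have : 0 ≤ normD θ φ 1 (u₀ - w₀) := Real.sqrt_nonneg _
          gcongr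
      _ < ε := by rwa [mul_comm, ← lt_div_iff₀ hp]
  · obtain ⟨σ, hσ, h⟩ := hmain η
    -- The extra `1` in the rate absorbs `t ^ α ≤ exp t`; the Mittag-Leffler factor enters only
    -- through being at least `1`.
    refine ⟨σ + 1, by positivity, fun I hI u₀ w₀ u w hu₀ hw₀ hu hw t ht => ?_⟩
    have ht0 : 0 ≤ t := hI.2.1 ht
    have hN : 0 ≤ normD θ φ 1 (u₀ - w₀) := Real.sqrt_nonneg _
    have hE : 1 ≤ mittagLeffler α 1 (3 * Real.Gamma α / 4 * t ^ α) := by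
      have := Real.Gamma_pos_of_pos hα.1
      exact one_le_mittagLeffler hα.1 (by positivity)
    calc t ^ α * Real.exp (-(σ + 1) * t) * normD θ φ 1 (u t - w t)
        ≤ Real.exp t * Real.exp (-(σ + 1) * t) *
            (M * Real.exp (σ * t) * normD θ φ 1 (u₀ - w₀)) := by
          gcongr
          · exact Real.sqrt_nonneg _
          · exact rpow_le_exp hα ht0
          · exact h I hI u₀ w₀ u w hu₀ hw₀ hu hw t ht
      _ = M * normD θ φ 1 (u₀ - w₀) *
            (Real.exp t * Real.exp (-(σ + 1) * t) * Real.exp (σ * t)) := by ring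
      _ = M * normD θ φ 1 (u₀ - w₀) * 1 := by
          rw [← Real.exp_add, ← Real.exp_add]
          ring_nf
          simp
      _ ≤ _ := by gcongr
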